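/- Let $f:\mathbb{R}^d\to\mathbb{R}$ be twice continuously differentiable. Suppose that for some $L>0$ and $m>0$ we have, for all $x,y\in\mathbb{R}^d$, $$\|\nabla f(x)-\nabla f(y)\|_2\le L\|x-y\|_2,\qquad f(y)\ge f(x)+\langle\nabla f(x),y-x\rangle+\tfrac m2\|x-y\|_2^2 ,$$ and put $\kappa=L/m$. Let $\gamma=2$ and $u=1/L$, and consider the underdamped Langevin diffusion $$dv_t=-\gamma v_t\,dt-u\nabla f(x_t)\,dt+\sqrt{2\gamma u}\,dB_t,\qquad dx_t=v_t\,dt,$$ where $B$ is a standard Brownian motion in $\mathbb{R}^d$. For a probability measure $p$ on $\mathbb{R}^{2d}$, let $\Phi_t p$ denote the law of $(x_t,v_t)$ when $(x_0,v_0)\sim p$ is independent of $B$. Let $(x_0,v_0)$ and $(y_0,w_0)$ be arbitrary points of $\mathbb{R}^{2d}$, and let $p_0=\delta_{(x_0,v_0)}$ and $p_0'=\delta_{(y_0,w_0)}$. Then for every $t>0$ there is a coupling $\zeta_t$ of $\Phi_t p_0$ and $\Phi_t p_0'$ (a probability measure on $\mathbb{R}^{2d}\times\mathbb{R}^{2d}$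 with these marginals) such that $$\mathbb{E}_{(x_t,v_t,y_t,w_t)\sim\zeta_t}\left[\|x_t-y_t\|_2^2+\|(x_t+v_t)-(y_t+w_t)\|_2^2\right]\le e^{-t/\kappa}\left\{\|x_0-y_0\|_2^2+\|(x_0+v_0)-(y_0+w_0)\|_2^2\right\}.$$ Moreover, $\zeta_t$ can be taken to be the synchronous coupling: the joint law at time $t$ of two solutions, started at $(x_0,v_0)$ and at $(y_0,w_0)$, that are driven by the same Brownian motion. -/

import Mathlib

open MeasureTheory ProbabilityTheory
open scoped NNReal

noncomputable section

/-- `B` is a standard Brownian motion in `ℝᵈ` under `P`: its coordinates are independent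
standard real Brownian motions (started at `0`, with almost surely continuous paths). -/
structure IsStandardBrownianMotion {d : ℕ} {Ω : Type*} [MeasurableSpace Ω]
    (B : ℝ≥0 → Ω → EuclideanSpace ℝ (Fin d)) (P : Measure Ω) : Prop where
  isBrownianReal : ∀ i : Fin d, IsBrownianReal (fun t ω ↦ B t ω i) P
  iIndepFun : iIndepFun (fun (i : Fin d) (ω : Ω) (t : ℝ≥0) ↦ B t ω i) P

/-- `(X, V)` solves the underdamped Langevin equation
`dv = -γ v dt - u ∇f(x) dt + √(2γu) dB`, `dx = v dt` with initial law `p₀`, driven by the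
standard Brownian motion `B` on the probability space `(Ω, P)`.
The noise is additive, so the equation is the pathwise integral equation stated here. -/
structure IsUnderdampedLangevin {d : ℕ} {Ω : Type*} [MeasurableSpace Ω]
    (f : EuclideanSpace ℝ (Fin d) → ℝ) (γ u : ℝ)
    (p₀ : Measure (EuclideanSpace ℝ (Fin d) × EuclideanSpace ℝ (Fin d)))
    (B X V : ℝ≥0 → Ω → EuclideanSpace ℝ (Fin d)) (P : Measure Ω) : Prop where
  isProbabilityMeasure : IsProbabilityMeasure P
  brownian : IsStandardBrownianMotion B P
  aemeasurable_position : ∀ t, AEMeasurable (X t) P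
  aemeasurable_velocity : ∀ t, AEMeasurable (V t) P
  hasLaw_zero : HasLaw (fun ω ↦ (X 0 ω, V 0 ω)) p₀ P
  indepFun_zero : IndepFun (fun ω ↦ (X 0 ω, V 0 ω)) (fun ω t ↦ B t ω) P
  continuous_position : ∀ᵐ ω ∂P, Continuous fun t ↦ X t ω
  continuous_velocity : ∀ᵐ ω ∂P, Continuous fun t ↦ V t ω
  position_eq : ∀ᵐ ω ∂P, ∀ t : ℝ≥0,
    X t ω = X 0 ω + ∫ s in (0 : ℝ)..t, V s.toNNReal ω
  velocity_eq : ∀ᵐ ω ∂P, ∀ t : ℝ≥0,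
    V t ω = V 0 ω
      + (∫ s in (0 : ℝ)..t, (-(γ • V s.toNNReal ω) - u • gradient f (X s.toNNReal ω)))
      + √(2 * γ * u) • B t ω

/-- The law at time `t` of a process `(X, V)` with values in `ℝᵈ × ℝᵈ`. For a solution of the
underdamped Langevin equation with initial law `p₀` this is `Φ_t p₀`. -/
def lawAt {d : ℕ} {Ω : Type*} [MeasurableSpace Ω]
    (X V : ℝ≥0 → Ω → EuclideanSpace ℝ (Fin d)) (P : Measure Ω) (t : ℝ≥0) :
    Measure (EuclideanSpace ℝ (Fin d) × EuclideanSpace ℝ (Fin d)) :=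
  P.map fun ω ↦ (X t ω, V t ω)

/-- `ζ` is a coupling (transference plan) of `μ` and `ν`. -/
structure IsCoupling {α β : Type*} [MeasurableSpace α] [MeasurableSpace β]
    (ζ : Measure (α × β)) (μ : Measure α) (ν : Measure β) : Prop where
  isProbabilityMeasure : IsProbabilityMeasure ζ
  fst_eq : ζ.fst = μ
  snd_eq : ζ.snd = ν

/-- The squared distance `‖x - y‖² + ‖(x + v) - (y + w)‖²` of `(x, v)` and `(y, w)`. -/
def twistedSqDist {d : ℕ}
    (a b : EuclideanSpace ℝ (Fin d) × EuclideanSpace ℝ (Fin d)) : ℝ :=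
  ‖a.1 - b.1‖ ^ 2 + ‖(a.1 + a.2) - (b.1 + b.2)‖ ^ 2

end

/-! Drive both solutions with the same Brownian motion. The noise is additive, so it cancels in the
difference, and the estimate becomes deterministic along almost every path. Put `a = x - y`, `b = a
+ (v - w)` and `g = (∇f x - ∇f y) / L`. With `γ = 2` and `u = 1 / L` these satisfy `a' = b - a` and
`b' = a - b - g`, hence `(‖a‖² + ‖b‖²)' = -2 (‖a‖² + ‖b‖²) + 2 ⟪b, 2 a - g⟫`. Heuristically `g` is a
symmetric matrix with spectrum in `[m / L, 1]` applied to `a`, so `‖2 a - g‖ ≤ (2 - m / L) ‖a‖`;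
cocoercivity proves this in `norm_two_smul_sub_gradient_le`. Cauchy-Schwarz and `2 ‖a‖ ‖b‖ ≤ ‖a‖² +
‖b‖²` then give decay at rate `m / L = 1 / κ` (`sq_norm_add_sq_norm_le_exp`).

The two given solutions may live on different probability spaces, so the second must be rebuilt on
the first space. The drift is Lipschitz, so Picard iteration solves the equation path by path and
makes the solution a measurable functional of the Brownian path. Pathwise uniqueness, together with
uniqueness of the Brownian law on path space, gives uniqueness in law
(`IsUnderdampedLangevin.lawAt_eq`). The rebuilt solution therefore has the required marginal. -/

noncomputable section

/-! ### Convexity and cocoercivity estimates for the gradient. -/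

section Gradient

variable {H : Type*} [NormedAddCommGroup H] [InnerProductSpace ℝ H] [CompleteSpace H]
  {f : H → ℝ} {L m : ℝ}

/-- The quadratic upper bound for a function with Lipschitz gradient. -/
theorem le_add_inner_gradient_add_sq (hf : Differentiable ℝ f)
    (hL : ∀ x y, ‖gradient f x - gradient f y‖ ≤ L * ‖x - y‖) (y z : H) :
    f z ≤ f y + inner ℝ (gradient f y) (z - y) + L / 2 * ‖z - y‖ ^ 2 := by
  set h := z - y with hh
  -- The claim is `φ 1 ≤ φ 0`; the Lipschitz bound along the segment makes `φ' ≤ 0`.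
  let φ : ℝ → ℝ := fun t ↦ f (y + t • h) - t * inner ℝ (gradient f y) h - L / 2 * t ^ 2 * ‖h‖ ^ 2
  have hφ (t : ℝ) : HasDerivAt φ
      (inner ℝ (gradient f (y + t • h)) h - inner ℝ (gradient f y) h - L * t * ‖h‖ ^ 2) t := by
    have h1 : HasDerivAt (fun t : ℝ ↦ y + t • h) h t := by
      simpa using ((hasDerivAt_id t).smul_const h).const_add y
    have h2 := (hf (y + t • h)).hasGradientAt.hasFDerivAt.comp_hasDerivAt t h1
    have h3 := (h2.sub ((hasDerivAt_id t).mul_const (inner ℝ (gradient f y) h))).sub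
      (((hasDerivAt_pow 2 t).const_mul (L / 2)).mul_const (‖h‖ ^ 2))
    refine h3.congr_deriv ?_
    rw [InnerProductSpace.toDual_apply_apply]
    push_cast
    ring
  have hanti : AntitoneOn φ (Set.Ici 0) := by
    refine antitoneOn_of_deriv_nonpos (convex_Ici 0)
      (fun t _ ↦ (hφ t).continuousAt.continuousWithinAt)
      (fun t _ ↦ (hφ t).differentiableAt.differentiableWithinAt) fun t ht ↦ ?_
    rw [interior_Ici, Set.mem_Ioi] at ht
    rw [(hφ t).deriv, ← inner_sub_left]
    have h1 := real_inner_le_norm (gradient f (y + t • h) - gradient f y) h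
    have h2 := hL (y + t • h) y
    rw [add_sub_cancel_left, norm_smul, Real.norm_of_nonneg ht.le] at h2
    nlinarith [mul_le_mul_of_nonneg_right h2 (norm_nonneg h)]
  have := hanti (Set.mem_Ici.2 le_rfl) (Set.mem_Ici.2 zero_le_one) zero_le_one
  simp only [φ, one_smul, zero_smul, add_zero, one_mul, zero_mul, one_pow, mul_one] at this
  rw [show y + h = z by rw [hh]; abel] at this
  linarith

/-- Strong convexity makes the gradient strongly monotone. -/
theorem mul_sq_le_inner_gradient_sub
    (hm : ∀ x y, f y ≥ f x + inner ℝ (gradient f x) (y - x) + m / 2 * ‖x - y‖ ^ 2) (x y : H) :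
    m * ‖x - y‖ ^ 2 ≤ inner ℝ (gradient f x - gradient f y) (x - y) := by
  have h1 := hm x y
  have h2 := hm y x
  rw [norm_sub_rev y x] at h2
  rw [← neg_sub x y, inner_neg_right] at h1
  rw [inner_sub_left]
  linarith

/-- Cocoercivity of the gradient of a strongly convex function with Lipschitz gradient. -/
theorem sq_norm_gradient_sub_sub_smul_le (hf : Differentiable ℝ f) (hL0 : 0 < L) (hm0 : 0 ≤ m)
    (hL : ∀ x y, ‖gradient f x - gradient f y‖ ≤ L * ‖x - y‖)
    (hm : ∀ x y, f y ≥ f x + inner ℝ (gradient f x) (y - x) + m / 2 * ‖x - y‖ ^ 2) (x y : H) :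
    ‖gradient f x - gradient f y - m • (x - y)‖ ^ 2
      ≤ L * inner ℝ (gradient f x - gradient f y - m • (x - y)) (x - y) := by
  have key (x y : H) : ‖gradient f x - gradient f y - m • (x - y)‖ ^ 2 / (2 * L)
      ≤ f y - f x - inner ℝ (gradient f x) (y - x) - m / 2 * ‖x - y‖ ^ 2 := by
    set q := gradient f x - gradient f y - m • (x - y) with hq
    -- Compare the lower bound based at `x` with the upper bound based at `y` at one test point, a
    -- gradient step from `y` for `f - m/2 ‖·‖²`. The optimal step is `1 / (L - m)`; the step `1 /
    -- L` also works when `L = m`.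
    have h1 := hm x (y + L⁻¹ • q)
    have h2 := le_add_inner_gradient_add_sq hf hL y (y + L⁻¹ • q)
    have e1 : y + L⁻¹ • q - x = (y - x) + L⁻¹ • q := by abel
    have e2 : x - (y + L⁻¹ • q) = (x - y) - L⁻¹ • q := by abel
    rw [e1, e2, inner_add_right, inner_smul_right, norm_sub_sq_real, inner_smul_right, norm_smul,
      Real.norm_of_nonneg (by positivity)] at h1
    rw [add_sub_cancel_left, inner_smul_right, norm_smul,
      Real.norm_of_nonneg (by positivity)] at h2
    have h3 : inner ℝ q q = inner ℝ (gradient f x) q - inner ℝ (gradient f y) q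
        - m * inner ℝ (x - y) q := by
      conv_lhs => rw [hq]
      rw [inner_sub_left, inner_sub_left, inner_smul_left]; rfl
    rw [real_inner_self_eq_norm_sq] at h3
    have h4 : inner ℝ (gradient f x) q = ‖q‖ ^ 2 + inner ℝ (gradient f y) q
        + m * inner ℝ (x - y) q := by linarith
    rw [h4] at h1
    have h5 : L⁻¹ * ‖q‖ ^ 2 - L / 2 * (L⁻¹ * ‖q‖) ^ 2 + m / 2 * (L⁻¹ * ‖q‖) ^ 2
        ≤ f y - f x - inner ℝ (gradient f x) (y - x) - m / 2 * ‖x - y‖ ^ 2 := by linarith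
    refine le_trans ?_ h5
    have h6 : L⁻¹ * ‖q‖ ^ 2 - L / 2 * (L⁻¹ * ‖q‖) ^ 2 = ‖q‖ ^ 2 / (2 * L) := by
      field_simp; ring
    rw [h6]
    exact le_add_of_nonneg_right (by positivity)
  -- Adding the two orderings cancels the values of `f`.
  have k1 := key x y
  have k2 := key y x
  have e : ‖gradient f y - gradient f x - m • (y - x)‖
      = ‖gradient f x - gradient f y - m • (x - y)‖ := by
    rw [← norm_neg]; congr 1; rw [← neg_sub x y, smul_neg]; abel
  rw [e, norm_sub_rev y x] at k2
  have h7 : inner ℝ (gradient f x - gradient f y - m • (x - y)) (x - y)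
      = - inner ℝ (gradient f x) (y - x) - inner ℝ (gradient f y) (x - y) - m * ‖x - y‖ ^ 2 := by
    rw [inner_sub_left, inner_sub_left, inner_smul_left, real_inner_self_eq_norm_sq,
      ← neg_sub x y, inner_neg_right]
    simp
  rw [h7]
  have h8 : ‖gradient f x - gradient f y - m • (x - y)‖ ^ 2
    = L * (‖gradient f x - gradient f y - m • (x - y)‖ ^ 2 / (2 * L)
      + ‖gradient f x - gradient f y - m • (x - y)‖ ^ 2 / (2 * L)) := by
    field_simp; ring
  rw [h8]
  refine mul_le_mul_of_nonneg_left ?_ hL0.le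
  linarith

/-- Strong monotonicity and Cauchy-Schwarz squeeze `⟪∇f x - ∇f y, x - y⟫` between `m ‖x - y‖²` and
`L ‖x - y‖²`; two distinct points are needed to divide. -/
theorem strongConvexity_le_lipschitz [Nontrivial H]
    (hL : ∀ x y, ‖gradient f x - gradient f y‖ ≤ L * ‖x - y‖)
    (hm : ∀ x y, f y ≥ f x + inner ℝ (gradient f x) (y - x) + m / 2 * ‖x - y‖ ^ 2) : m ≤ L := by
  obtain ⟨x, y, hxy⟩ := exists_pair_ne H
  have h0 : 0 < ‖x - y‖ := norm_pos_iff.2 (sub_ne_zero.2 hxy)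
  have h1 := mul_sq_le_inner_gradient_sub hm x y
  have h2 := real_inner_le_norm (gradient f x - gradient f y) (x - y)
  have h3 := mul_le_mul_of_nonneg_right (hL x y) h0.le
  have h4 : m * ‖x - y‖ ^ 2 ≤ L * ‖x - y‖ ^ 2 := by linarith
  exact le_of_mul_le_mul_right h4 (by positivity)

/-- The displacement under the map `2 x - L⁻¹ ∇f x` is at most `2 - m / L` times as long. -/
theorem norm_two_smul_sub_gradient_le (hf : Differentiable ℝ f) (hL0 : 0 < L) (hm0 : 0 ≤ m)
    (hmL : m ≤ L)
    (hL : ∀ x y, ‖gradient f x - gradient f y‖ ≤ L * ‖x - y‖)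
    (hm : ∀ x y, f y ≥ f x + inner ℝ (gradient f x) (y - x) + m / 2 * ‖x - y‖ ^ 2) (x y : H) :
    ‖(2 : ℝ) • (x - y) - (1 / L) • (gradient f x - gradient f y)‖ ≤ (2 - m / L) * ‖x - y‖ := by
  have h1 := sq_norm_gradient_sub_sub_smul_le hf hL0 hm0 hL hm x y
  set q := gradient f x - gradient f y - m • (x - y) with hq
  have hc : m / L ≤ 1 := (div_le_one hL0).2 hmL
  have e : (2 : ℝ) • (x - y) - (1 / L) • (gradient f x - gradient f y)
      = (2 - m / L) • (x - y) - (1 / L) • q := by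
    rw [hq, smul_sub (1 / L) _ (m • _), smul_smul, sub_smul]
    have : 1 / L * m = m / L := by ring
    rw [this]; abel
  have hq0 : 0 ≤ inner ℝ q (x - y) := by
    have := sq_nonneg ‖q‖
    exact nonneg_of_mul_nonneg_right (this.trans h1) hL0
  rw [e]
  refine le_of_sq_le_sq ?_ (mul_nonneg (by linarith) (norm_nonneg _))
  rw [norm_sub_sq_real, inner_smul_left, inner_smul_right, real_inner_comm, norm_smul, norm_smul,
    Real.norm_of_nonneg (by linarith : 0 ≤ 2 - m / L), Real.norm_of_nonneg (by positivity),
    mul_pow (1 / L)]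
  -- Cocoercivity bounds the quadratic term by `⟪q, x - y⟫ / L`. The cross term subtracts `2 (2 - m
  -- / L)` times this quantity, which is at least as much because `m ≤ L`.
  have h2 : (1 / L) ^ 2 * ‖q‖ ^ 2 ≤ 1 / L * inner ℝ q (x - y) := by
    calc (1 / L) ^ 2 * ‖q‖ ^ 2 ≤ (1 / L) ^ 2 * (L * inner ℝ q (x - y)) := by gcongr
      _ = _ := by field_simp
  have h3 : 0 ≤ 1 / L * inner ℝ q (x - y) := by positivity
  simp only [conj_trivial]
  nlinarith

end Gradient

/-! ### Exponential contraction of the difference system. -/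

/-- A function on `ℝ≥0` with a continuous integrand extends to a differentiable one on `ℝ`. -/
theorem hasDerivAt_add_integral_toNNReal {E : Type*} [NormedAddCommGroup E] [NormedSpace ℝ E]
    [CompleteSpace E] {φ : ℝ≥0 → E} (hφ : Continuous φ) (a : E) (t : ℝ) :
    HasDerivAt (fun t : ℝ ↦ a + ∫ s in (0 : ℝ)..t, φ s.toNNReal) (φ t.toNNReal) t :=
  ((hφ.comp continuous_real_toNNReal).integral_hasStrictDerivAt 0 t).hasDerivAt.const_add a

/-- Two trajectories of the noise-cancelled twisted dynamics `a' = b - a`, `b' = a - b - g`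
approach each other exponentially when `‖2 a - g‖ ≤ (2 - c) ‖a‖`. -/
theorem sq_norm_add_sq_norm_le_exp {H : Type*} [NormedAddCommGroup H] [InnerProductSpace ℝ H]
    [CompleteSpace H] {a b g : ℝ≥0 → H} {c : ℝ} (hc : c ≤ 2)
    (ha : Continuous a) (hb : Continuous b) (hg : Continuous g)
    (hag : ∀ t, ‖(2 : ℝ) • a t - g t‖ ≤ (2 - c) * ‖a t‖)
    (hda : ∀ t : ℝ≥0, a t = a 0 + ∫ s in (0 : ℝ)..t, (b s.toNNReal - a s.toNNReal))
    (hdb : ∀ t : ℝ≥0, b t = b 0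
      + ∫ s in (0 : ℝ)..t, (a s.toNNReal - b s.toNNReal - g s.toNNReal)) (t : ℝ≥0) :
    ‖a t‖ ^ 2 + ‖b t‖ ^ 2 ≤ Real.exp (-(c * t)) * (‖a 0‖ ^ 2 + ‖b 0‖ ^ 2) := by
  let A : ℝ → H := fun t ↦ a 0 + ∫ s in (0 : ℝ)..t, (b s.toNNReal - a s.toNNReal)
  let B : ℝ → H := fun t ↦ b 0
    + ∫ s in (0 : ℝ)..t, (a s.toNNReal - b s.toNNReal - g s.toNNReal)
  have hA (t : ℝ≥0) : A t = a t := (hda t).symm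
  have hB (t : ℝ≥0) : B t = b t := (hdb t).symm
  have dA (t : ℝ) : HasDerivAt A (b t.toNNReal - a t.toNNReal) t :=
    hasDerivAt_add_integral_toNNReal (hb.sub ha) (a 0) t
  have dB (t : ℝ) : HasDerivAt B (a t.toNNReal - b t.toNNReal - g t.toNNReal) t :=
    hasDerivAt_add_integral_toNNReal ((ha.sub hb).sub hg) (b 0) t
  -- Gronwall by an integrating factor: the claim is that `N` is antitone on `[0, ∞)`.
  let N : ℝ → ℝ := fun t ↦ Real.exp (c * t) * (‖A t‖ ^ 2 + ‖B t‖ ^ 2)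
  have dN (t : ℝ) := (((hasDerivAt_id t).const_mul c).exp).mul ((dA t).norm_sq.add (dB t).norm_sq)
  have hanti : AntitoneOn N (Set.Ici 0) := by
    refine antitoneOn_of_deriv_nonpos (convex_Ici 0)
      (fun t _ ↦ (dN t).continuousAt.continuousWithinAt)
      (fun t _ ↦ (dN t).differentiableAt.differentiableWithinAt) fun t ht ↦ ?_
    rw [interior_Ici, Set.mem_Ioi] at ht
    lift t to ℝ≥0 using ht.le
    refine (dN t).deriv.trans_le ?_
    simp only [id_eq, mul_one, Pi.add_apply, hA, hB, Real.toNNReal_coe]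
    have h1 := real_inner_le_norm (b t) ((2 : ℝ) • a t - g t)
    have h2 := mul_le_mul_of_nonneg_left (hag t) (norm_nonneg (b t))
    rw [inner_sub_right, inner_smul_right] at h1
    simp only [inner_sub_right, real_inner_self_eq_norm_sq]
    rw [real_inner_comm (b t) (a t)]
    have h3 : (2 - c) * (2 * (‖b t‖ * ‖a t‖)) ≤ (2 - c) * (‖a t‖ ^ 2 + ‖b t‖ ^ 2) :=
      mul_le_mul_of_nonneg_left (by nlinarith [sq_nonneg (‖a t‖ - ‖b t‖)]) (by linarith)
    rw [mul_assoc, ← mul_add]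
    refine mul_nonpos_of_nonneg_of_nonpos (Real.exp_pos _).le ?_
    linarith
  have := hanti (Set.mem_Ici.2 le_rfl) (Set.mem_Ici.2 t.2) t.2
  have h0 : A 0 = a 0 := by simp [A]
  have h0' : B 0 = b 0 := by simp [B]
  simp only [N, mul_zero, Real.exp_zero, one_mul, h0, h0'] at this
  erw [hA, hB] at this
  rw [Real.exp_neg, inv_mul_eq_div, le_div_iff₀ (Real.exp_pos _), mul_comm]
  exact this

/-! ### Picard iteration for integral equations with Lipschitz drift. -/

section Picard

open Filter Topology

theorem exists_norm_le_of_le {G : Type*} [SeminormedAddCommGroup G] {z : ℝ≥0 → G}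
    (hz : Continuous z) (T : ℝ≥0) :
    ∃ M, ∀ t ≤ T, ‖z t‖ ≤ M := by
  obtain ⟨M, hM⟩ := (isCompact_Icc (a := (0 : ℝ≥0)) (b := T)).exists_bound_of_continuousOn
    hz.continuousOn
  exact ⟨M, fun t ht ↦ hM t ⟨zero_le, ht⟩⟩

variable {E : Type*} [NormedAddCommGroup E] [NormedSpace ℝ E]

/-- The Picard map of the integral equation `z t = c t + ∫₀ᵗ F (z s) ds`. -/
def picardStep (F : E → E) (c z : ℝ≥0 → E) (t : ℝ≥0) : E :=
  c t + ∫ s in (0 : ℝ)..t, F (z s.toNNReal)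

/-- The Picard iterates of the integral equation `z t = c t + ∫₀ᵗ F (z s) ds`. -/
def picardIterate (F : E → E) (c : ℝ≥0 → E) (n : ℕ) : ℝ≥0 → E :=
  (picardStep F c)^[n] c

/-- The limit of the Picard iterates of the integral equation `z t = c t + ∫₀ᵗ F (z s) ds`. -/
def picardLimit (F : E → E) (c : ℝ≥0 → E) (t : ℝ≥0) : E :=
  limUnder atTop fun n ↦ picardIterate F c n t

variable {F : E → E} {c z w : ℝ≥0 → E} {K : ℝ≥0}

theorem picardIterate_succ (n : ℕ) :
    picardIterate F c (n + 1) = picardStep F c (picardIterate F c n) :=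
  Function.iterate_succ_apply' _ _ _

theorem continuous_picardStep (hF : Continuous F) (hc : Continuous c) (hz : Continuous z) :
    Continuous (picardStep F c z) := by
  have h : Continuous fun s : ℝ ↦ F (z s.toNNReal) := by fun_prop
  exact hc.add ((intervalIntegral.continuous_primitive (fun a b ↦ h.intervalIntegrable a b) 0).comp
    NNReal.continuous_coe)

theorem continuous_picardIterate (hF : Continuous F) (hc : Continuous c) (n : ℕ) :
    Continuous (picardIterate F c n) := by
  induction n with
  | zero => exact hc
  | succ n ih =>
    rw [picardIterate_succ]
    exact continuous_picardStep hF hc ih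

/-- The Picard map improves a bound of order `n` to one of order `n + 1`. -/
theorem norm_picardStep_sub_le (hF : LipschitzWith K F) (hz : Continuous z) (hw : Continuous w)
    {M : ℝ} {T : ℝ≥0} {n : ℕ}
    (h : ∀ t ≤ T, ‖z t - w t‖ ≤ M * ((K * t : ℝ) ^ n / n.factorial)) {t : ℝ≥0} (ht : t ≤ T) :
    ‖picardStep F c z t - picardStep F c w t‖
      ≤ M * ((K * t : ℝ) ^ (n + 1) / (n + 1).factorial) := by
  have hF' := hF.continuous
  have hFz : Continuous fun s : ℝ ↦ F (z s.toNNReal) := by fun_prop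
  have hFw : Continuous fun s : ℝ ↦ F (w s.toNNReal) := by fun_prop
  rw [picardStep, picardStep, add_sub_add_left_eq_sub,
    ← intervalIntegral.integral_sub (hFz.intervalIntegrable _ _) (hFw.intervalIntegrable _ _)]
  have hint : ∫ s in (0 : ℝ)..t, K * (M * ((K * s : ℝ) ^ n / n.factorial))
      = M * ((K * t : ℝ) ^ (n + 1) / (n + 1).factorial) := by
    have e (s : ℝ) : K * (M * ((K * s : ℝ) ^ n / n.factorial))
        = (M * K ^ (n + 1) / n.factorial) * s ^ n := by
      rw [mul_pow]; ring
    simp_rw [e]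
    rw [intervalIntegral.integral_const_mul, integral_pow, Nat.factorial_succ, mul_pow]
    push_cast
    have := Nat.factorial_pos n
    field_simp
    simp
  rw [← hint]
  refine intervalIntegral.norm_integral_le_of_norm_le t.2 (Eventually.of_forall fun s hs ↦ ?_)
    (Continuous.intervalIntegrable (by fun_prop) _ _)
  have h1 := hF.dist_le_mul (z s.toNNReal) (w s.toNNReal)
  rw [dist_eq_norm, dist_eq_norm] at h1
  have h2 := h s.toNNReal ((Real.toNNReal_le_iff_le_coe.2 hs.2).trans ht)
  rw [Real.coe_toNNReal _ hs.1.le] at h2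
  exact h1.trans (mul_le_mul_of_nonneg_left h2 K.2)

/-- Continuous solutions of the integral equation `z t = c t + ∫₀ᵗ F (z s) ds` are unique. -/
theorem eq_of_eq_picardStep (hF : LipschitzWith K F) (hz : Continuous z) (hw : Continuous w)
    (hz' : ∀ t, z t = picardStep F c z t) (hw' : ∀ t, w t = picardStep F c w t) : z = w := by
  funext T
  obtain ⟨M, hM⟩ := exists_norm_le_of_le (hz.sub hw) T
  have key (n : ℕ) : ∀ t ≤ T, ‖z t - w t‖ ≤ M * ((K * t : ℝ) ^ n / n.factorial) := by
    induction n with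
    | zero => simpa using hM
    | succ n ih =>
      intro t ht
      rw [hz' t, hw' t]
      exact norm_picardStep_sub_le hF hz hw ih ht
  have h0 := (FloorSemiring.tendsto_pow_div_factorial_atTop (K * T : ℝ)).const_mul M
  rw [mul_zero] at h0
  have := ge_of_tendsto' h0 fun n ↦ key n T le_rfl
  exact sub_eq_zero.1 (norm_le_zero_iff.1 this)

theorem exists_norm_picardIterate_sub_le (hF : LipschitzWith K F) (hc : Continuous c) (T : ℝ≥0) :
    ∃ M, ∀ n, ∀ t ≤ T, ‖picardIterate F c (n + 1) t - picardIterate F c n t‖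
      ≤ M * ((K * t : ℝ) ^ n / n.factorial) := by
  have hcont := continuous_picardIterate hF.continuous hc
  obtain ⟨M, hM⟩ := exists_norm_le_of_le ((hcont 1).sub (hcont 0)) T
  refine ⟨M, fun n ↦ ?_⟩
  induction n with
  | zero => simpa using hM
  | succ n ih =>
    intro t ht
    rw [picardIterate_succ (n + 1), picardIterate_succ n]
    rw [picardIterate_succ n] at ih
    exact norm_picardStep_sub_le hF (continuous_picardStep hF.continuous hc (hcont n)) (hcont n)
      ih ht

/-- Telescoping bounds every iterate by an exponential series, uniformly on `[0, T]`. This supplies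
the dominating constant when passing to the limit under the integral. -/
theorem exists_norm_picardIterate_le (hF : LipschitzWith K F) (hc : Continuous c) (T : ℝ≥0) :
    ∃ C, ∀ n, ∀ t ≤ T, ‖picardIterate F c n t‖ ≤ C := by
  obtain ⟨M, hM⟩ := exists_norm_picardIterate_sub_le hF hc T
  obtain ⟨C, hC⟩ := exists_norm_le_of_le hc T
  have hM0 : 0 ≤ M := by simpa using (norm_nonneg _).trans (hM 0 0 zero_le)
  have hs := (Real.summable_pow_div_factorial (K * T : ℝ)).mul_left M
  refine ⟨C + ∑' n : ℕ, M * ((K * T : ℝ) ^ n / n.factorial), fun n t ht ↦ ?_⟩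
  have h1 : picardIterate F c n t = c t
      + ∑ i ∈ Finset.range n, (picardIterate F c (i + 1) t - picardIterate F c i t) := by
    rw [Finset.sum_range_sub (fun i ↦ picardIterate F c i t)]
    simp [picardIterate]
  rw [h1]
  refine (norm_add_le _ _).trans (add_le_add (hC t ht) ?_)
  refine (norm_sum_le _ _).trans (le_trans (Finset.sum_le_sum fun i _ ↦ ?_)
    (hs.sum_le_tsum (Finset.range n) fun i _ ↦ by positivity))
  refine (hM i t ht).trans ?_
  gcongr

variable [CompleteSpace E]

theorem tendsto_picardIterate (hF : LipschitzWith K F) (hc : Continuous c) (t : ℝ≥0) :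
    Tendsto (fun n ↦ picardIterate F c n t) atTop (𝓝 (picardLimit F c t)) := by
  obtain ⟨M, hM⟩ := exists_norm_picardIterate_sub_le hF hc t
  refine (cauchySeq_of_dist_le_of_summable _ (fun n ↦ ?_)
    ((Real.summable_pow_div_factorial (K * t : ℝ)).mul_left M)).tendsto_limUnder
  rw [dist_comm, dist_eq_norm]
  exact hM n t le_rfl

/-- The limit of the Picard iterates solves the integral equation. -/
theorem picardLimit_eq_picardStep (hF : LipschitzWith K F) (hc : Continuous c) (t : ℝ≥0) :
    picardLimit F c t = picardStep F c (picardLimit F c) t := by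
  obtain ⟨C, hC⟩ := exists_norm_picardIterate_le hF hc t
  have hF' := hF.continuous
  have hcont := continuous_picardIterate hF' hc
  -- The shifted iterates converge to the limit, and by dominated convergence also to its Picard
  -- image.
  refine tendsto_nhds_unique ((tendsto_picardIterate hF hc t).comp (tendsto_add_atTop_nat 1)) ?_
  have e : (fun n ↦ picardIterate F c n t) ∘ (fun n ↦ n + 1)
      = fun n ↦ c t + ∫ s in (0 : ℝ)..t, F (picardIterate F c n s.toNNReal) := by
    funext n
    simp only [Function.comp_apply, picardIterate_succ, picardStep]
  rw [e]
  refine Tendsto.const_add _ (intervalIntegral.tendsto_integral_filter_of_dominated_convergence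
    (fun _ ↦ ‖F 0‖ + K * C) (Eventually.of_forall fun n ↦ ?_)
    (Eventually.of_forall fun n ↦ Eventually.of_forall fun s hs ↦ ?_) (by simp)
    (Eventually.of_forall fun s _ ↦ ?_))
  · have := hcont n
    exact Continuous.aestronglyMeasurable (by fun_prop)
  · rw [Set.uIoc_of_le t.coe_nonneg] at hs
    have h1 := hF.dist_le_mul (picardIterate F c n s.toNNReal) 0
    rw [dist_eq_norm, dist_eq_norm, sub_zero] at h1
    have h2 := hC n s.toNNReal (Real.toNNReal_le_iff_le_coe.2 hs.2)
    have h3 := norm_le_norm_add_norm_sub' (F (picardIterate F c n s.toNNReal)) (F 0)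
    have h4 := mul_le_mul_of_nonneg_left h2 K.2
    exact h3.trans (add_le_add le_rfl (h1.trans h4))
  · exact (hF'.tendsto _).comp (tendsto_picardIterate hF hc s.toNNReal)

/-- The limit is measurable and locally bounded, so its drift is locally integrable. The fixed-point
equation then writes it as `c` plus a primitive, which is continuous. -/
theorem continuous_picardLimit [SecondCountableTopology E] (hF : LipschitzWith K F)
    (hc : Continuous c) : Continuous (picardLimit F c) := by
  borelize E
  have hF' := hF.continuous
  have hcont := continuous_picardIterate hF' hc
  have hmeas : Measurable (picardLimit F c) :=
    measurable_of_tendsto_metrizable (fun n ↦ (hcont n).measurable)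
      (tendsto_pi_nhds.2 fun t ↦ tendsto_picardIterate hF hc t)
  have hmeas' : Measurable fun s : ℝ ↦ F (picardLimit F c s.toNNReal) :=
    hF'.measurable.comp (hmeas.comp measurable_real_toNNReal)
  have hint (T : ℝ≥0) : IntervalIntegrable (fun s : ℝ ↦ F (picardLimit F c s.toNNReal)) volume
      0 T := by
    obtain ⟨C, hC⟩ := exists_norm_picardIterate_le hF hc T
    refine IntervalIntegrable.mono_fun' (g := fun _ ↦ ‖F 0‖ + K * C) (by simp)
      hmeas'.aestronglyMeasurable ?_
    refine (ae_restrict_iff' measurableSet_uIoc).2 (Eventually.of_forall fun s hs ↦ ?_)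
    rw [Set.uIoc_of_le T.coe_nonneg] at hs
    have h1 := hF.dist_le_mul (picardLimit F c s.toNNReal) 0
    rw [dist_eq_norm, dist_eq_norm, sub_zero] at h1
    have h2 : ‖picardLimit F c s.toNNReal‖ ≤ C :=
      le_of_tendsto' (tendsto_picardIterate hF hc s.toNNReal).norm fun n ↦
        hC n s.toNNReal (Real.toNNReal_le_iff_le_coe.2 hs.2)
    have h3 := norm_le_norm_add_norm_sub' (F (picardLimit F c s.toNNReal)) (F 0)
    exact h3.trans (add_le_add le_rfl (h1.trans (mul_le_mul_of_nonneg_left h2 K.2)))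
  rw [funext (picardLimit_eq_picardStep hF hc)]
  refine hc.add (continuous_iff_continuousAt.2 fun t ↦ ?_)
  have h1 := intervalIntegral.continuousOn_primitive_interval' (hint (t + 1))
    (Set.left_mem_uIcc)
  have h2 : ContinuousOn (fun t : ℝ≥0 ↦ ∫ s in (0 : ℝ)..t, F (picardLimit F c s.toNNReal))
      (Set.Iic (t + 1)) := by
    refine h1.comp NNReal.continuous_coe.continuousOn fun s hs ↦ ?_
    rw [Set.uIcc_of_le (t + 1).coe_nonneg]
    exact ⟨s.2, NNReal.coe_le_coe.2 hs⟩
  exact h2.continuousAt (Iic_mem_nhds (lt_add_one t))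

/-- Each iterate is continuous in time and measurable in `ω`, hence jointly measurable, so its time
integral is measurable in `ω`. Pointwise limits preserve this. -/
theorem measurable_picardLimit [SecondCountableTopology E] [MeasurableSpace E] [BorelSpace E]
    {Ω : Type*} [MeasurableSpace Ω] {c : Ω → ℝ≥0 → E} (hF : LipschitzWith K F)
    (hc : ∀ ω, Continuous (c ω)) (hc' : ∀ t, Measurable fun ω ↦ c ω t) (t : ℝ≥0) :
    Measurable fun ω ↦ picardLimit F (c ω) t := by
  have hF' := hF.continuous
  have hcont (n : ℕ) (ω : Ω) := continuous_picardIterate hF' (hc ω) n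
  have key (n : ℕ) : ∀ t, Measurable fun ω ↦ picardIterate F (c ω) n t := by
    induction n with
    | zero => exact hc'
    | succ n ih =>
      intro t
      simp only [picardIterate_succ, picardStep]
      refine (hc' t).add ?_
      have h1 : Measurable (Function.uncurry fun (s : ℝ) (ω : Ω) ↦
          F (picardIterate F (c ω) n s.toNNReal)) := by
        refine measurable_uncurry_of_continuous_of_measurable (fun ω ↦ ?_) fun s ↦ ?_
        · have := hcont n ω
          fun_prop
        · exact hF'.measurable.comp (ih _)
      have h2 := h1.stronglyMeasurable.integral_prod_left (μ := volume.restrict (Set.Ioc (0 : ℝ) t))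
      simp_rw [intervalIntegral.integral_of_le t.coe_nonneg]
      exact h2.measurable
  exact measurable_of_tendsto_metrizable (fun n ↦ key n t)
    (tendsto_pi_nhds.2 fun ω ↦ tendsto_picardIterate hF (hc ω) t)

end Picard

/-! ### Measurable path-valued versions of continuous processes. -/

section PathSpace

open Filter Topology

/-- The space of continuous paths in `E` that start at `0`, with the `σ`-algebra generated by the
evaluations. -/
abbrev CenteredPath (E : Type*) [TopologicalSpace E] [Zero E] : Type _ :=
  {b : ℝ≥0 → E // Continuous b ∧ b 0 = 0}

/-- A process with almost surely continuous paths starting at `0` has a measurable version with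
values in the path space. -/
theorem exists_measurable_centeredPath {Ω E : Type*} [MeasurableSpace Ω] {P : Measure Ω}
    [TopologicalSpace E] [TopologicalSpace.PseudoMetrizableSpace E] [Zero E] [MeasurableSpace E]
    [BorelSpace E] {B : ℝ≥0 → Ω → E} (hB : ∀ t, AEMeasurable (B t) P)
    (hcont : ∀ᵐ ω ∂P, Continuous fun t ↦ B t ω) (h0 : ∀ᵐ ω ∂P, B 0 ω = 0) :
    ∃ β : Ω → CenteredPath E, Measurable β ∧ ∀ᵐ ω ∂P, ∀ t, (β ω).1 t = B t ω := by
  classical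
  let q := TopologicalSpace.denseSeq ℝ≥0
  have hq : DenseRange q := TopologicalSpace.denseRange_denseSeq ℝ≥0
  have hae : ∀ᵐ ω ∂P, (∀ n, B (q n) ω = (hB (q n)).mk _ ω) ∧ Continuous (fun t ↦ B t ω)
      ∧ B 0 ω = 0 := by
    filter_upwards [ae_all_iff.2 fun n ↦ (hB (q n)).ae_eq_mk, hcont, h0] with ω h1 h2 h3
    exact ⟨h1, h2, h3⟩
  obtain ⟨N, hN, hNm, hN0⟩ := exists_measurable_superset_of_null (ae_iff.1 hae)
  have hgood (ω : Ω) (hω : ω ∉ N) : (∀ n, B (q n) ω = (hB (q n)).mk _ ω)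
      ∧ Continuous (fun t ↦ B t ω) ∧ B 0 ω = 0 := by
    by_contra h
    exact hω (hN h)
  refine ⟨fun ω ↦ if hω : ω ∈ N then ⟨fun _ ↦ 0, continuous_const, rfl⟩
    else ⟨fun t ↦ B t ω, (hgood ω hω).2⟩, ?_, ?_⟩
  · refine measurable_comap_iff.2 (measurable_pi_lambda _ fun t ↦ ?_)
    have hval : (fun ω ↦ (Subtype.val ∘ fun ω ↦ (if hω : ω ∈ N then
        ⟨fun _ ↦ 0, continuous_const, rfl⟩ else ⟨fun t ↦ B t ω, (hgood ω hω).2⟩ :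
          CenteredPath E)) ω t) = Nᶜ.indicator (B t) := by
      funext ω
      by_cases hω : ω ∈ N <;> simp [hω]
    rw [hval]
    -- Measurable modifications are taken at countably many times only; continuity off `N` carries
    -- measurability to every `t`.
    obtain ⟨x, hx, hxt⟩ := mem_closure_iff_seq_limit.1 (hq t)
    choose φ hφ using hx
    refine measurable_of_tendsto_metrizable
      (f := fun n ↦ Nᶜ.indicator ((hB (q (φ n))).mk (B (q (φ n)))))
      (fun n ↦ (hB (q (φ n))).measurable_mk.indicator hNm.compl) (tendsto_pi_nhds.2 fun ω ↦ ?_)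
    by_cases hω : ω ∈ N
    · simpa [hω] using tendsto_const_nhds
    · simp only [Set.indicator_of_mem (Set.mem_compl hω), ← (hgood ω hω).1 _]
      simp only [hφ]
      exact ((hgood ω hω).2.1.tendsto t).comp hxt
  · filter_upwards [measure_eq_zero_iff_ae_notMem.1 hN0] with ω hω t
    rw [dif_neg hω]

end PathSpace

/-! ### Uniqueness of the Brownian law on path space. -/

section BrownianLaw

open BrownianReal

variable {d : ℕ} {Ω Ω' : Type*} [MeasurableSpace Ω] [MeasurableSpace Ω'] {P : Measure Ω}
  {P' : Measure Ω'} {B : ℝ≥0 → Ω → EuclideanSpace ℝ (Fin d)}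
  {B' : ℝ≥0 → Ω' → EuclideanSpace ℝ (Fin d)}

theorem IsStandardBrownianMotion.aemeasurable (hB : IsStandardBrownianMotion B P) (t : ℝ≥0) :
    AEMeasurable (B t) P := by
  have h := aemeasurable_pi_lambda (fun ω i ↦ B t ω i)
    fun i ↦ (hB.isBrownianReal i).toIsPreBrownianReal.aemeasurable t
  exact (MeasurableEquiv.toLp 2 (Fin d → ℝ)).measurable.comp_aemeasurable h

theorem IsStandardBrownianMotion.continuous (hB : IsStandardBrownianMotion B P) :
    ∀ᵐ ω ∂P, Continuous fun t ↦ B t ω := by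
  filter_upwards [ae_all_iff.2 fun i ↦ (hB.isBrownianReal i).cont] with ω h
  exact (PiLp.continuous_toLp 2 _).comp (continuous_pi h)

theorem IsStandardBrownianMotion.eval_zero (hB : IsStandardBrownianMotion B P) :
    ∀ᵐ ω ∂P, B 0 ω = 0 := by
  filter_upwards [ae_all_iff.2 fun i ↦
    (hB.isBrownianReal i).toIsPreBrownianReal.eval_zero_ae_eq_zero] with ω h
  ext i
  exact h i

/-- Two pre-Brownian motions with measurable path maps have the same law on path space. -/
theorem map_eq_of_isPreBrownianReal {b : ℝ≥0 → Ω → ℝ} {b' : ℝ≥0 → Ω' → ℝ}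
    (hb : IsPreBrownianReal b P) (hb' : IsPreBrownianReal b' P')
    (hm : Measurable fun ω t ↦ b t ω) (hm' : Measurable fun ω t ↦ b' t ω) :
    P.map (fun ω t ↦ b t ω) = P'.map (fun ω t ↦ b' t ω) := by
  -- Both laws are projective limits of the same finite-dimensional Brownian laws.
  refine IsProjectiveLimit.unique (P := projectiveFamily) (fun I ↦ ?_) fun I ↦ ?_
  · rw [Measure.map_map (Finset.measurable_restrict I) hm]
    exact (hb.hasLaw I).map_eq
  · rw [Measure.map_map (Finset.measurable_restrict I) hm']
    exact (hb'.hasLaw I).map_eq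

theorem measurable_centeredPath_coord {β : Ω → CenteredPath (EuclideanSpace ℝ (Fin d))}
    (hβ : Measurable β) (i : Fin d) : Measurable fun ω t ↦ (β ω).1 t i :=
  measurable_pi_lambda _ fun t ↦ (EuclideanSpace.proj (𝕜 := ℝ) i).measurable.comp
    ((measurable_pi_apply t).comp hβ.subtype_val)

/-- Measurable path-valued versions of two standard Brownian motions have the same law. -/
theorem IsStandardBrownianMotion.map_eq [IsProbabilityMeasure P] [IsProbabilityMeasure P']
    (hB : IsStandardBrownianMotion B P) (hB' : IsStandardBrownianMotion B' P')
    {β : Ω → CenteredPath (EuclideanSpace ℝ (Fin d))}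
    {β' : Ω' → CenteredPath (EuclideanSpace ℝ (Fin d))} (hβ : Measurable β) (hβ' : Measurable β')
    (h : ∀ᵐ ω ∂P, ∀ t, (β ω).1 t = B t ω) (h' : ∀ᵐ ω ∂P', ∀ t, (β' ω).1 t = B' t ω) :
    P.map β = P'.map β' := by
  let toPath (x : Fin d → ℝ≥0 → ℝ) (t : ℝ≥0) : EuclideanSpace ℝ (Fin d) :=
    WithLp.toLp 2 fun i ↦ x i t
  have htoPath : Measurable toPath := by
    refine measurable_pi_lambda _ fun t ↦
      (MeasurableEquiv.toLp 2 (Fin d → ℝ)).measurable.comp (measurable_pi_lambda _ fun i ↦ ?_)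
    fun_prop
  -- By independence each joint law is the product of its coordinate laws, which agree.
  have hlaw : P.map (fun ω i t ↦ (β ω).1 t i) = P'.map (fun ω i t ↦ (β' ω).1 t i) := by
    have hi : ProbabilityTheory.iIndepFun (fun i ω t ↦ (β ω).1 t i) P := by
      refine ProbabilityTheory.iIndepFun.congr (fun i ↦ ?_) hB.iIndepFun
      filter_upwards [h] with ω hω
      simp only [hω]
    have hi' : ProbabilityTheory.iIndepFun (fun i ω t ↦ (β' ω).1 t i) P' := by
      refine ProbabilityTheory.iIndepFun.congr (fun i ↦ ?_) hB'.iIndepFun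
      filter_upwards [h'] with ω hω
      simp only [hω]
    rw [(iIndepFun_iff_map_fun_eq_pi_map fun i ↦
      (measurable_centeredPath_coord hβ i).aemeasurable).1 hi,
      (iIndepFun_iff_map_fun_eq_pi_map fun i ↦
      (measurable_centeredPath_coord hβ' i).aemeasurable).1 hi']
    congr 1
    funext i
    refine map_eq_of_isPreBrownianReal (b := fun t ω ↦ (β ω).1 t i) (b' := fun t ω ↦ (β' ω).1 t i)
      ((hB.isBrownianReal i).toIsPreBrownianReal.congr fun t ↦ ?_)
      ((hB'.isBrownianReal i).toIsPreBrownianReal.congr fun t ↦ ?_) (measurable_centeredPath_coord hβ i) (measurable_centeredPath_coord hβ' i)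
    · filter_upwards [h] with ω hω
      simp only [hω]
    · filter_upwards [h'] with ω hω
      simp only [hω]
  have hval : P.map (fun ω ↦ (β ω).1) = P'.map (fun ω ↦ (β' ω).1) := by
    have := congrArg (Measure.map toPath) hlaw
    rwa [Measure.map_map htoPath (measurable_pi_lambda _ (measurable_centeredPath_coord hβ)),
      Measure.map_map htoPath (measurable_pi_lambda _ (measurable_centeredPath_coord hβ'))] at this
  ext s hs
  obtain ⟨u, hu, rfl⟩ := hs
  rw [Measure.map_apply hβ (measurable_subtype_coe hu),
    Measure.map_apply hβ' (measurable_subtype_coe hu)]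
  have := congrArg (fun μ ↦ μ u) hval
  simp only [Measure.map_apply hβ.subtype_val hu, Measure.map_apply hβ'.subtype_val hu] at this
  exact this

end BrownianLaw

/-! ### Existence, uniqueness and contraction for the Langevin equation. -/

section Langevin

variable {d : ℕ} {f : EuclideanSpace ℝ (Fin d) → ℝ} {γ u : ℝ} {K : ℝ≥0}
  {x v : EuclideanSpace ℝ (Fin d)}

/-- The drift of the underdamped Langevin equation. -/
def langevinDrift (f : EuclideanSpace ℝ (Fin d) → ℝ) (γ u : ℝ)
    (z : EuclideanSpace ℝ (Fin d) × EuclideanSpace ℝ (Fin d)) :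
    EuclideanSpace ℝ (Fin d) × EuclideanSpace ℝ (Fin d) :=
  (z.2, -(γ • z.2) - u • gradient f z.1)

/-- The initial point plus the accumulated noise in the underdamped Langevin equation. -/
def langevinForcing (γ u : ℝ) (x v : EuclideanSpace ℝ (Fin d))
    (b : ℝ≥0 → EuclideanSpace ℝ (Fin d)) (t : ℝ≥0) :
    EuclideanSpace ℝ (Fin d) × EuclideanSpace ℝ (Fin d) :=
  (x, v + √(2 * γ * u) • b t)

theorem lipschitzWith_langevinDrift (hf : LipschitzWith K (gradient f)) :
    LipschitzWith (max 1 (‖γ‖₊ * 1 + ‖u‖₊ * (K * 1))) (langevinDrift f γ u) :=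
  LipschitzWith.prod_snd.prodMk
    (((lipschitzWith_smul γ).comp LipschitzWith.prod_snd).neg.sub
      ((lipschitzWith_smul u).comp (hf.comp LipschitzWith.prod_fst)))

theorem continuous_langevinForcing {b : ℝ≥0 → EuclideanSpace ℝ (Fin d)} (hb : Continuous b) :
    Continuous (langevinForcing γ u x v b) := by
  unfold langevinForcing
  fun_prop

/-- Integrals of pairs are computed coordinatewise, so the abstract fixed-point equation is exactly
the position and velocity equations. -/
theorem picardStep_langevin (hf : Continuous (gradient f))
    {b X V : ℝ≥0 → EuclideanSpace ℝ (Fin d)} (hX : Continuous X) (hV : Continuous V) (t : ℝ≥0) :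
    picardStep (langevinDrift f γ u) (langevinForcing γ u x v b) (fun t ↦ (X t, V t)) t
      = (x + ∫ s in (0 : ℝ)..t, V s.toNNReal,
        v + (∫ s in (0 : ℝ)..t, (-(γ • V s.toNNReal) - u • gradient f (X s.toNNReal)))
          + √(2 * γ * u) • b t) := by
  have h : IntervalIntegrable
      (fun s : ℝ ↦ langevinDrift f γ u (X s.toNNReal, V s.toNNReal)) volume 0 t := by
    refine Continuous.intervalIntegrable ?_ _ _
    unfold langevinDrift
    fun_prop
  have h1 := (ContinuousLinearMap.fst ℝ (EuclideanSpace ℝ (Fin d))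
    (EuclideanSpace ℝ (Fin d))).intervalIntegral_comp_comm h
  have h2 := (ContinuousLinearMap.snd ℝ (EuclideanSpace ℝ (Fin d))
    (EuclideanSpace ℝ (Fin d))).intervalIntegral_comp_comm h
  simp only [ContinuousLinearMap.coe_fst', ContinuousLinearMap.coe_snd'] at h1 h2
  simp only [langevinDrift] at h1 h2
  ext1
  · rw [h1]
    simp only [picardStep, langevinForcing, langevinDrift, Prod.fst_add]
  · rw [h2]
    simp only [picardStep, langevinForcing, langevinDrift, Prod.snd_add]
    abel

/-- The solution of the underdamped Langevin equation driven by the path `b`. -/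
def langevinFlow (f : EuclideanSpace ℝ (Fin d) → ℝ) (γ u : ℝ) (x v : EuclideanSpace ℝ (Fin d))
    (t : ℝ≥0) (b : CenteredPath (EuclideanSpace ℝ (Fin d))) :
    EuclideanSpace ℝ (Fin d) × EuclideanSpace ℝ (Fin d) :=
  picardLimit (langevinDrift f γ u) (langevinForcing γ u x v b.1) t

theorem measurable_langevinFlow (hf : LipschitzWith K (gradient f)) (t : ℝ≥0) :
    Measurable (langevinFlow f γ u x v t) := by
  have hc (t : ℝ≥0) : Measurable fun b : CenteredPath (EuclideanSpace ℝ (Fin d)) ↦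
      langevinForcing γ u x v b.1 t := by
    have h : Measurable fun b : CenteredPath (EuclideanSpace ℝ (Fin d)) ↦ b.1 t :=
      (measurable_pi_apply t).comp measurable_subtype_coe
    exact measurable_const.prodMk (measurable_const.add (h.const_smul (√(2 * γ * u))))
  exact measurable_picardLimit (lipschitzWith_langevinDrift hf)
    (fun b ↦ continuous_langevinForcing b.2.1) hc t

theorem continuous_langevinFlow (hf : LipschitzWith K (gradient f))
    (b : CenteredPath (EuclideanSpace ℝ (Fin d))) :
    Continuous fun t ↦ langevinFlow f γ u x v t b :=
  continuous_picardLimit (lipschitzWith_langevinDrift hf) (continuous_langevinForcing b.2.1)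

theorem langevinFlow_eq (hf : LipschitzWith K (gradient f))
    (b : CenteredPath (EuclideanSpace ℝ (Fin d))) (t : ℝ≥0) :
    langevinFlow f γ u x v t b = (x + ∫ s in (0 : ℝ)..t, (langevinFlow f γ u x v s.toNNReal b).2,
      v + (∫ s in (0 : ℝ)..t, (-(γ • (langevinFlow f γ u x v s.toNNReal b).2)
        - u • gradient f (langevinFlow f γ u x v s.toNNReal b).1)) + √(2 * γ * u) • b.1 t) := by
  have hc := continuous_langevinFlow (γ := γ) (u := u) (x := x) (v := v) hf b
  rw [← picardStep_langevin hf.continuous hc.fst hc.snd]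
  exact picardLimit_eq_picardStep (lipschitzWith_langevinDrift hf)
    (continuous_langevinForcing b.2.1) t

theorem langevinFlow_zero (hf : LipschitzWith K (gradient f))
    (b : CenteredPath (EuclideanSpace ℝ (Fin d))) : langevinFlow f γ u x v 0 b = (x, v) := by
  rw [langevinFlow_eq hf]
  simp [b.2.2]

variable {Ω Ω' : Type*} [MeasurableSpace Ω] [MeasurableSpace Ω'] {P : Measure Ω}
  {P' : Measure Ω'} {B X V : ℝ≥0 → Ω → EuclideanSpace ℝ (Fin d)}
  {B' Y W : ℝ≥0 → Ω' → EuclideanSpace ℝ (Fin d)}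
  {β : Ω → CenteredPath (EuclideanSpace ℝ (Fin d))}
  {β' : Ω' → CenteredPath (EuclideanSpace ℝ (Fin d))}

/-- Strong existence for the underdamped Langevin equation. -/
theorem isUnderdampedLangevin_langevinFlow [IsProbabilityMeasure P]
    (hf : LipschitzWith K (gradient f)) (hB : IsStandardBrownianMotion B P) (hβ : Measurable β)
    (h : ∀ᵐ ω ∂P, ∀ t, (β ω).1 t = B t ω) :
    IsUnderdampedLangevin f γ u (Measure.dirac (x, v)) B
      (fun t ω ↦ (langevinFlow f γ u x v t (β ω)).1)
      (fun t ω ↦ (langevinFlow f γ u x v t (β ω)).2) P where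
  isProbabilityMeasure := inferInstance
  brownian := hB
  aemeasurable_position t := ((measurable_langevinFlow hf t).comp hβ).fst.aemeasurable
  aemeasurable_velocity t := ((measurable_langevinFlow hf t).comp hβ).snd.aemeasurable
  hasLaw_zero := hasLaw_dirac_of_ae_eq (.of_forall fun ω ↦ langevinFlow_zero hf _)
  indepFun_zero := by
    simp only [langevinFlow_zero hf]
    exact indepFun_const_left (x, v) _
  continuous_position := .of_forall fun ω ↦ (continuous_langevinFlow hf _).fst
  continuous_velocity := .of_forall fun ω ↦ (continuous_langevinFlow hf _).snd
  position_eq := .of_forall fun ω t ↦ by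
    rw [langevinFlow_zero hf, langevinFlow_eq hf]
  velocity_eq := by
    filter_upwards [h] with ω hω t
    rw [langevinFlow_zero hf, langevinFlow_eq hf, hω]

theorem IsUnderdampedLangevin.eval_zero
    (hXV : IsUnderdampedLangevin f γ u (Measure.dirac (x, v)) B X V P) :
    ∀ᵐ ω ∂P, X 0 ω = x ∧ V 0 ω = v := by
  filter_upwards [hXV.hasLaw_zero.ae_eq_of_dirac] with ω hω
  exact Prod.ext_iff.1 hω

/-- Pathwise uniqueness for the underdamped Langevin equation. -/
theorem IsUnderdampedLangevin.ae_eq_langevinFlow (hf : LipschitzWith K (gradient f))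
    (hXV : IsUnderdampedLangevin f γ u (Measure.dirac (x, v)) B X V P)
    (h : ∀ᵐ ω ∂P, ∀ t, (β ω).1 t = B t ω) :
    ∀ᵐ ω ∂P, ∀ t, (X t ω, V t ω) = langevinFlow f γ u x v t (β ω) := by
  filter_upwards [h, hXV.eval_zero, hXV.continuous_position, hXV.continuous_velocity,
    hXV.position_eq, hXV.velocity_eq] with ω hω h0 hX hV hXeq hVeq
  refine congrFun (eq_of_eq_picardStep (lipschitzWith_langevinDrift (γ := γ) (u := u) hf) (hX.prodMk hV)
    (continuous_langevinFlow hf (β ω)) (c := langevinForcing γ u x v (β ω).1) (fun t ↦ ?_)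
    fun t ↦ ?_)
  · rw [picardStep_langevin hf.continuous hX hV, ← h0.1, ← h0.2, hω, ← hXeq, ← hVeq]
  · exact picardLimit_eq_picardStep (lipschitzWith_langevinDrift hf)
      (continuous_langevinForcing (β ω).2.1) t

theorem IsStandardBrownianMotion.exists_centeredPath (hB : IsStandardBrownianMotion B P) :
    ∃ β : Ω → CenteredPath (EuclideanSpace ℝ (Fin d)),
      Measurable β ∧ ∀ᵐ ω ∂P, ∀ t, (β ω).1 t = B t ω :=
  exists_measurable_centeredPath hB.aemeasurable hB.continuous hB.eval_zero

/-- Uniqueness in law for the underdamped Langevin equation. -/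
theorem IsUnderdampedLangevin.lawAt_eq (hf : LipschitzWith K (gradient f))
    (hXV : IsUnderdampedLangevin f γ u (Measure.dirac (x, v)) B X V P)
    (hYW : IsUnderdampedLangevin f γ u (Measure.dirac (x, v)) B' Y W P') (t : ℝ≥0) :
    lawAt X V P t = lawAt Y W P' t := by
  have := hXV.isProbabilityMeasure
  have := hYW.isProbabilityMeasure
  obtain ⟨β, hβ, h⟩ := hXV.brownian.exists_centeredPath
  obtain ⟨β', hβ', h'⟩ := hYW.brownian.exists_centeredPath
  -- By pathwise uniqueness the law is the image of the Brownian path law under a map that does not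
  -- depend on the probability space.
  have e : lawAt X V P t = (P.map β).map (langevinFlow f γ u x v t) := by
    rw [Measure.map_map (measurable_langevinFlow hf t) hβ]
    refine Measure.map_congr ?_
    filter_upwards [hXV.ae_eq_langevinFlow hf h] with ω hω using hω t
  have e' : lawAt Y W P' t = (P'.map β').map (langevinFlow f γ u x v t) := by
    rw [Measure.map_map (measurable_langevinFlow hf t) hβ']
    refine Measure.map_congr ?_
    filter_upwards [hYW.ae_eq_langevinFlow hf h'] with ω hω using hω t
  rw [e, e', hXV.brownian.map_eq hYW.brownian hβ hβ' h h']

/-- Two solutions of the underdamped Langevin equation driven by the same Brownian motion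
approach each other exponentially, almost surely. -/
theorem IsUnderdampedLangevin.twistedSqDist_le {L m : ℝ} (hL : 0 < L) (hm : 0 < m)
    (hf : Differentiable ℝ f)
    (hf_smooth : ∀ x y, ‖gradient f x - gradient f y‖ ≤ L * ‖x - y‖)
    (hf_convex : ∀ x y, f y ≥ f x + inner ℝ (gradient f x) (y - x) + m / 2 * ‖x - y‖ ^ 2)
    {Y W : ℝ≥0 → Ω → EuclideanSpace ℝ (Fin d)} {x₀ v₀ y₀ w₀ : EuclideanSpace ℝ (Fin d)}
    (hXV : IsUnderdampedLangevin f 2 (1 / L) (Measure.dirac (x₀, v₀)) B X V P)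
    (hYW : IsUnderdampedLangevin f 2 (1 / L) (Measure.dirac (y₀, w₀)) B Y W P) :
    ∀ᵐ ω ∂P, ∀ t : ℝ≥0, twistedSqDist (X t ω, V t ω) (Y t ω, W t ω)
      ≤ Real.exp (-(t : ℝ) / (L / m)) * twistedSqDist (x₀, v₀) (y₀, w₀) := by
  -- For `d = 0` the inequality `m ≤ L` may fail, but all distances vanish.
  rcases subsingleton_or_nontrivial (EuclideanSpace ℝ (Fin d)) with hs | hs
  · refine .of_forall fun ω t ↦ ?_
    have h0 (z : EuclideanSpace ℝ (Fin d)) : ‖z‖ = 0 := by rw [Subsingleton.elim z 0, norm_zero]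
    simp [twistedSqDist, h0]
  have hmL : m ≤ L := strongConvexity_le_lipschitz hf_smooth hf_convex
  have hgrad : Continuous (gradient f) :=
    (LipschitzWith.of_dist_le_mul (K := L.toNNReal) fun x y ↦ by
      rw [Real.coe_toNNReal _ hL.le, dist_eq_norm, dist_eq_norm]
      exact hf_smooth x y).continuous
  filter_upwards [hXV.eval_zero, hXV.continuous_position, hXV.continuous_velocity,
    hXV.position_eq, hXV.velocity_eq, hYW.eval_zero, hYW.continuous_position,
    hYW.continuous_velocity, hYW.position_eq, hYW.velocity_eq]
    with ω hX0 hX hV hXeq hVeq hY0 hY hW hYeq hWeq t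
  have hint {φ : ℝ≥0 → EuclideanSpace ℝ (Fin d)} (hφ : Continuous φ) (t : ℝ) :
      IntervalIntegrable (fun s : ℝ ↦ φ s.toNNReal) volume 0 t :=
    (hφ.comp continuous_real_toNNReal).intervalIntegrable _ _
  have hXg : Continuous fun t ↦ -((2 : ℝ) • V t ω) - (1 / L) • gradient f (X t ω) := by fun_prop
  have hYg : Continuous fun t ↦ -((2 : ℝ) • W t ω) - (1 / L) • gradient f (Y t ω) := by fun_prop
  have hda (t : ℝ≥0) : X t ω - Y t ω = (X 0 ω - Y 0 ω)
      + ∫ s in (0 : ℝ)..t, (V s.toNNReal ω - W s.toNNReal ω) := by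
    rw [intervalIntegral.integral_sub (hint hV t) (hint hW t), hXeq t, hYeq t]
    abel
  -- Both velocities carry the same term in `B t ω`, which cancels here.
  have hdv (t : ℝ≥0) : V t ω - W t ω = (V 0 ω - W 0 ω)
      + ∫ s in (0 : ℝ)..t, ((-((2 : ℝ) • V s.toNNReal ω) - (1 / L) • gradient f (X s.toNNReal ω))
        - (-((2 : ℝ) • W s.toNNReal ω) - (1 / L) • gradient f (Y s.toNNReal ω))) := by
    rw [intervalIntegral.integral_sub (hint hXg t) (hint hYg t), hVeq t, hWeq t]
    abel
  have key := sq_norm_add_sq_norm_le_exp (a := fun t ↦ X t ω - Y t ω)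
    (b := fun t ↦ (X t ω - Y t ω) + (V t ω - W t ω))
    (g := fun t ↦ (1 / L) • (gradient f (X t ω) - gradient f (Y t ω))) (c := m / L)
    (by have := (div_le_one hL).2 hmL; linarith) (by fun_prop) (by fun_prop) (by fun_prop)
    (fun t ↦ norm_two_smul_sub_gradient_le hf hL hm.le hmL hf_smooth hf_convex _ _)
    (fun t ↦ by
      simp only [add_sub_cancel_left]
      exact hda t)
    (fun t ↦ by
      rw [hda t, hdv t, add_add_add_comm, ← intervalIntegral.integral_add]
      · congr 1
        refine intervalIntegral.integral_congr fun s _ ↦ ?_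
        module
      · exact hint (hV.sub hW) t
      · exact hint (hXg.sub hYg) t) t
  simp only [hX0.1, hX0.2, hY0.1, hY0.2] at key
  have e : -(t : ℝ) / (L / m) = -(m / L * t) := by
    field_simp
  rw [e, twistedSqDist, twistedSqDist, add_sub_add_comm, add_sub_add_comm]
  exact key

end Langevin

end

/-! ### The synchronous coupling. -/

theorem measurable_twistedSqDist {d : ℕ} :
    Measurable fun z : (EuclideanSpace ℝ (Fin d) × EuclideanSpace ℝ (Fin d)) ×
      (EuclideanSpace ℝ (Fin d) × EuclideanSpace ℝ (Fin d)) ↦ twistedSqDist z.1 z.2 := by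
  unfold twistedSqDist
  fun_prop

theorem theorem3 {d : ℕ} (f : EuclideanSpace ℝ (Fin d) → ℝ) (L m : ℝ)
    (hL : 0 < L) (hm : 0 < m)
    (hf : ContDiff ℝ 2 f)
    (hf_smooth : ∀ x y, ‖gradient f x - gradient f y‖ ≤ L * ‖x - y‖)
    (hf_convex : ∀ x y, f y ≥ f x + inner ℝ (gradient f x) (y - x) + m / 2 * ‖x - y‖ ^ 2)
    (x₀ v₀ y₀ w₀ : EuclideanSpace ℝ (Fin d))
    {Ω : Type*} [MeasurableSpace Ω] (P : Measure Ω)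
    (B X V : ℝ≥0 → Ω → EuclideanSpace ℝ (Fin d))
    (hXV : IsUnderdampedLangevin f 2 (1 / L) (Measure.dirac (x₀, v₀)) B X V P)
    {Ω' : Type*} [MeasurableSpace Ω'] (P' : Measure Ω')
    (B' Y W : ℝ≥0 → Ω' → EuclideanSpace ℝ (Fin d))
    (hYW : IsUnderdampedLangevin f 2 (1 / L) (Measure.dirac (y₀, w₀)) B' Y W P') :
    ∃ Y₁ W₁ : ℝ≥0 → Ω → EuclideanSpace ℝ (Fin d),
      IsUnderdampedLangevin f 2 (1 / L) (Measure.dirac (y₀, w₀)) B Y₁ W₁ P ∧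
      ∀ t : ℝ≥0, 0 < t →
        ∃ ζ : Measure ((EuclideanSpace ℝ (Fin d) × EuclideanSpace ℝ (Fin d)) ×
            (EuclideanSpace ℝ (Fin d) × EuclideanSpace ℝ (Fin d))),
          IsCoupling ζ (lawAt X V P t) (lawAt Y W P' t) ∧
          ζ = P.map (fun ω ↦ ((X t ω, V t ω), (Y₁ t ω, W₁ t ω))) ∧
          Integrable (fun z ↦ twistedSqDist z.1 z.2) ζ ∧
          ∫ z, twistedSqDist z.1 z.2 ∂ζ
            ≤ Real.exp (-(t : ℝ) / (L / m)) * twistedSqDist (x₀, v₀) (y₀, w₀) := by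
  have hlip : LipschitzWith L.toNNReal (gradient f) := LipschitzWith.of_dist_le_mul fun x y ↦ by
    rw [Real.coe_toNNReal _ hL.le, dist_eq_norm, dist_eq_norm]
    exact hf_smooth x y
  have := hXV.isProbabilityMeasure
  obtain ⟨β, hβ, h⟩ := hXV.brownian.exists_centeredPath
  have hYW₁ := isUnderdampedLangevin_langevinFlow (γ := 2) (u := 1 / L) (x := y₀) (v := w₀) hlip
    hXV.brownian hβ h
  refine ⟨_, _, hYW₁, fun t _ ↦ ⟨_, ?_, rfl, ?_⟩⟩
  · have h₁ : AEMeasurable (fun ω ↦ (X t ω, V t ω)) P :=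
      (hXV.aemeasurable_position t).prodMk (hXV.aemeasurable_velocity t)
    have h₂ := (hYW₁.aemeasurable_position t).prodMk (hYW₁.aemeasurable_velocity t)
    refine ⟨Measure.isProbabilityMeasure_map (h₁.prodMk h₂), Measure.fst_map_prodMk₀ h₂, ?_⟩
    -- Uniqueness in law replaces the given second solution by the one rebuilt on `Ω`.
    rw [← hYW₁.lawAt_eq hlip hYW t]
    exact Measure.snd_map_prodMk₀ h₁
  · have hmeas := ((hXV.aemeasurable_position t).prodMk (hXV.aemeasurable_velocity t)).prodMk
      ((hYW₁.aemeasurable_position t).prodMk (hYW₁.aemeasurable_velocity t))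
    have hle : ∀ᵐ z ∂(P.map fun ω ↦ ((X t ω, V t ω), ((langevinFlow f 2 (1 / L) y₀ w₀ t (β ω)).1,
        (langevinFlow f 2 (1 / L) y₀ w₀ t (β ω)).2))), twistedSqDist z.1 z.2
          ≤ Real.exp (-(t : ℝ) / (L / m)) * twistedSqDist (x₀, v₀) (y₀, w₀) := by
      refine (ae_map_iff hmeas (measurableSet_le measurable_twistedSqDist measurable_const)).2 ?_
      filter_upwards [hXV.twistedSqDist_le hL hm (hf.differentiable (by norm_num)) hf_smooth
        hf_convex hYW₁] with ω hω using hω t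
    have := Measure.isProbabilityMeasure_map hmeas
    -- The almost sure contraction bound is a constant, so it yields integrability as well as the
    -- estimate of the mean.
    have hint := Integrable.of_bound measurable_twistedSqDist.aestronglyMeasurable _
      (hle.mono fun z hz ↦ by
        rwa [Real.norm_of_nonneg (by unfold twistedSqDist; positivity)])
    exact ⟨hint, (integral_mono_ae hint (integrable_const _) hle).trans_eq (by
      rw [integral_const, probReal_univ, one_smul])⟩
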